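/- Let $A$ be a commutative Noetherian ring and $\Gamma$ a finitely generated commutative monoid, and let $R=A[\Gamma]$ be the monoid ring. For an ideal $\mathfrak a\subseteq R$, let $\operatorname{grade}(\mathfrak a)$ be the maximal length of an $R$-regular sequence contained in $\mathfrak a$; a proper ideal $\mathfrak a$ is called perfect if $\operatorname{grade}(\mathfrak a)$ equals the projective dimension of the $R$-module $R/\mathfrak a$. Let $\operatorname{cd}(R,\mathfrak a)$ be the cohomological dimension of $\mathfrak a$, i.e. the least natural number $c$ such that the local cohomology modules $H^i_{\mathfrak a}(M)$ vanish for all $R$-modules $M$ and all $i>c$, and let $\operatorname{ht}(\mathfrak a)$ be the height of $\mathfrak a$. If $\mathfrak a\subsetneq R$ is a perfect ideal generated by (the images in $R$ of the elements of) a subset of $\Gamma$, then $$\operatorname{cd}(R,\mathfrak a)=\operatorname{ht}(\mathfrak a).$$ -/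

import Mathlib

universe u

/-- The grade of `I`: the maximal length of an `R`-regular sequence of elements of `I`. -/
noncomputable def Ideal.grade {R : Type u} [CommRing R] (I : Ideal R) : ℕ∞ :=
  ⨆ (rs : List R) (_ : RingTheory.Sequence.IsRegular R rs) (_ : ∀ r ∈ rs, r ∈ I),
    (rs.length : ℕ∞)

/-- An ideal `I` is perfect if the projective dimension of `R ⧸ I` is equal to the grade of `I`.
The projective dimension of the zero module is `⊥`, so a perfect ideal is a proper ideal. -/
def Ideal.IsPerfect {R : Type u} [CommRing R] (I : Ideal R) : Prop :=
  CategoryTheory.projectiveDimension (ModuleCat.of R (R ⧸ I)) = (I.grade : WithBot ℕ∞)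

/-- The cohomological dimension of `I`: the least `c` such that the local cohomology modules
`H_I^i(M)` vanish for all `R`-modules `M` and all `i > c` (and `⊤` if there is no such natural
number). -/
noncomputable def Ideal.cohomologicalDimension {R : Type u} [CommRing R] (I : Ideal R) : ℕ∞ :=
  sInf {c : ℕ∞ | ∀ (M : ModuleCat.{u} R) (i : ℕ), c < (i : ℕ∞) →
    CategoryTheory.Limits.IsZero ((localCohomology I i).obj M)}

-- Multiplication by t on Γ induces an endomorphism φ_t of R = A[Γ] that raises every monomial to
-- its t-th power. As 𝔞 is generated by finitely many monomials, 𝔞^(νt) ⊆ φ_t(𝔞)R ⊆ 𝔞^t for t ≥ 1,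
-- with ν independent of t. Let g be the grade of 𝔞, so that R/𝔞 has projective dimension g.
--
-- Cohomological dimension. φ_t need not be flat, but φ_t(𝔞)R contains powers of a regular sequence
-- of length g, and this keeps the projective dimension of R/φ_t(𝔞)R at most g
-- (`exists_torsionEmbeds_and_hasProjectiveDimensionLE`). Hence Ext^i(R/φ_t(𝔞)R, M) = 0 for i > g,
-- and by cofinality H^i_𝔞(M) = 0. Conversely, if g > 0, the nonzero module Ext^g(R/𝔞, R) injects
-- into H^g_𝔞(R).
--
-- Height. The inequality g ≤ ht 𝔞 is standard. Let P be minimal over 𝔞 and L = R_P, with maximal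
-- ideal m. Base change along R → R → L, the first map being φ_t, embeds L/φ_t(𝔞)L into b copies of
-- L modulo the (νt)-th powers of a regular sequence, with b independent of t; so its length is
-- O(t^g). As φ_t(𝔞)R ⊆ 𝔞^t, this length is at least that of L/m^t, which grows at least like t^(ht
-- P). Hence ht P ≤ g (`height_le_of_torsionEmbeds`).

universe v w

/-! ### Syzygies after base change -/

section

open TensorProduct RingTheory.Sequence CategoryTheory Pointwise

/-- Multiplication by every element of `a` on `K` factors through a projective module. -/
def FactorsThroughProjective {R : Type u} [CommRing R] (a : Ideal R) (K : Type u)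
    [AddCommGroup K] [Module R K] : Prop :=
  ∀ x ∈ a, ∃ (P : Type u) (_ : AddCommGroup P) (_ : Module R P) (_ : Module.Projective R P)
    (s : K →ₗ[R] P) (q : P →ₗ[R] K), ∀ k, q (s k) = x • k

/-- For every `R`-algebra `S`, every `S`-module `N` and every `N`-weakly regular sequence `xs` of
length `n` in `aS`, the submodule of elements of `N ⊗ K` killed by `xs` embeds into
`(N / xs N) ^ b`. -/
def TorsionEmbeds {R : Type u} [CommRing R] (a : Ideal R) (K : Type u)
    [AddCommGroup K] [Module R K] (n b : ℕ) : Prop :=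
  ∀ (S : Type u) [CommRing S] [Algebra R S] (N : Type u) [AddCommGroup N] [Module R N]
    [Module S N] [IsScalarTower R S N] (xs : List S), xs.length = n →
    (∀ x ∈ xs, x ∈ a.map (algebraMap R S)) → IsWeaklyRegular N xs →
    ∃ f : Submodule.torsionBySet S (N ⊗[R] K) {x | x ∈ xs} →ₗ[S]
      (Fin b → N ⧸ (Ideal.ofList xs • ⊤ : Submodule S N)), Function.Injective f

section

variable {R : Type u} [CommRing R] {a : Ideal R} {K F : Type u}
  [AddCommGroup K] [Module R K] [AddCommGroup F] [Module R F]

lemma FactorsThroughProjective.exists_section (hK : FactorsThroughProjective a K)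
    {p : F →ₗ[R] K} (hp : Function.Surjective p) {x : R} (hx : x ∈ a) :
    ∃ s : K →ₗ[R] F, ∀ k, p (s k) = x • k := by
  obtain ⟨P, _, _, _, s, q, h⟩ := hK x hx
  obtain ⟨q', hq'⟩ := Module.projective_lifting_property p q hp
  refine ⟨q' ∘ₗ s, fun k => ?_⟩
  rw [← h, ← hq']
  rfl

lemma FactorsThroughProjective.exists_retraction (hK : FactorsThroughProjective a K)
    {p : F →ₗ[R] K} (hp : Function.Surjective p) {x : R} (hx : x ∈ a) :
    ∃ h : F →ₗ[R] LinearMap.ker p, ∀ k : LinearMap.ker p, h k = x • k := by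
  obtain ⟨s, hs⟩ := hK.exists_section hp hx
  refine ⟨LinearMap.codRestrict _ (x • LinearMap.id - s ∘ₗ p) fun c => by simp [hs], fun k => ?_⟩
  ext
  simp

/-- The property passes to syzygies, so it propagates from R/a along a whole resolution. -/
lemma FactorsThroughProjective.ker [Module.Projective R F] (hK : FactorsThroughProjective a K)
    {p : F →ₗ[R] K} (hp : Function.Surjective p) :
    FactorsThroughProjective a (LinearMap.ker p) := fun x hx => by
  obtain ⟨h, hh⟩ := hK.exists_retraction hp hx
  exact ⟨F, _, _, inferInstance, (LinearMap.ker p).subtype, h, hh⟩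

lemma FactorsThroughProjective.quotient (a : Ideal R) :
    FactorsThroughProjective a (R ⧸ a) := fun x hx => by
  refine ⟨PUnit, inferInstance, inferInstance, inferInstance, 0, 0, fun k => ?_⟩
  obtain ⟨r, rfl⟩ := Ideal.Quotient.mk_surjective k
  simp only [LinearMap.zero_apply]
  rw [Algebra.smul_def, Ideal.Quotient.algebraMap_eq, Ideal.Quotient.eq_zero_iff_mem.2 hx,
    zero_mul]

variable {S : Type u} [CommRing S] [Algebra R S] {N : Type u} [AddCommGroup N] [Module R N]
    [Module S N] [IsScalarTower R S N]

lemma smul_eq_zero_of_mem_map {M : Type*} [AddCommGroup M] [Module S M] {u : M}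
    (h : ∀ x ∈ a, algebraMap R S x • u = 0) {y : S} (hy : y ∈ a.map (algebraMap R S)) :
    y • u = 0 := by
  have : a.map (algebraMap R S) ≤ LinearMap.ker (LinearMap.toSpanSingleton S M u) :=
    Ideal.map_le_iff_le_comap.2 fun x hx => by simpa using h x hx
  simpa using this hy

lemma isSMulRegular_tensor_fin_fun {x : S} (hx : IsSMulRegular N x) (m : ℕ) :
    IsSMulRegular (N ⊗[R] (Fin m → R)) x := by
  intro u v huv
  apply (TensorProduct.piScalarRight R S N (Fin m)).injective
  have h := congrArg (TensorProduct.piScalarRight R S N (Fin m)) huv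
  simp only [map_smul] at h
  funext i
  exact hx (congrFun h i)

/-- Tensoring with the projection `N → N / xN` has kernel `x (N ⊗ K)`. -/
lemma exists_smul_eq_of_rTensor_mk_eq_zero (x : S) (K : Type u) [AddCommGroup K] [Module R K]
    {w : N ⊗[R] K}
    (hw : AlgebraTensorModule.rTensor R K (Submodule.mkQ (x • ⊤ : Submodule S N)) w = 0) :
    ∃ w', w = x • w' := by
  have hex : Function.Exact ((LinearMap.lsmul S N x).restrictScalars R)
      ((Submodule.mkQ (x • ⊤ : Submodule S N)).restrictScalars R) := fun n => by
    simp [Submodule.mem_smul_pointwise_iff_exists]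
  have hsurj : Function.Surjective ((Submodule.mkQ (x • ⊤ : Submodule S N)).restrictScalars R) :=
    Submodule.mkQ_surjective (x • ⊤ : Submodule S N)
  obtain ⟨w', hw'⟩ := (rTensor_exact K hex hsurj w).1 hw
  refine ⟨w', hw'.symm.trans ?_⟩
  clear hw'
  induction w' with
  | zero => rw [map_zero, smul_zero]
  | add y z hy hz => rw [map_add, hy, hz, smul_add]
  | tmul y z => rfl

/-- The kernel is a Tor_1(N, K). For x in a, multiplication by x on ker p extends to F, hence it
annihilates everything that dies in N ⊗ F. -/
lemma ker_lTensor_subtype_smul (hK : FactorsThroughProjective a K)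
    {p : F →ₗ[R] K} (hp : Function.Surjective p) {u : N ⊗[R] LinearMap.ker p}
    (hu : AlgebraTensorModule.lTensor S N (LinearMap.ker p).subtype u = 0)
    {y : S} (hy : y ∈ a.map (algebraMap R S)) : y • u = 0 := by
  refine smul_eq_zero_of_mem_map (fun x hx => ?_) hy
  obtain ⟨h, hh⟩ := hK.exists_retraction hp hx
  have key : ∀ v : N ⊗[R] LinearMap.ker p,
      AlgebraTensorModule.lTensor S N h
        (AlgebraTensorModule.lTensor S N (LinearMap.ker p).subtype v) =
      algebraMap R S x • v := by
    intro v
    induction v with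
    | zero => simp
    | add y z hy hz => rw [map_add, map_add, hy, hz, smul_add]
    | tmul y z =>
      simp only [AlgebraTensorModule.lTensor_tmul, Submodule.subtype_apply, hh]
      rw [tmul_smul, smul_tmul', smul_tmul', algebraMap_smul]
  rw [← key u, hu, map_zero]

/-- If the elements of `N ⊗ ker p` killed by a weakly regular sequence embed as in `TorsionEmbeds`
and there is one more regular element available, then `N ⊗ ker p → N ⊗ F` is injective. -/
lemma TorsionEmbeds.lTensor_subtype_injective (hK : FactorsThroughProjective a K)
    {p : F →ₗ[R] K} (hp : Function.Surjective p) {n b : ℕ}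
    (hT : TorsionEmbeds a (LinearMap.ker p) n b) {xs : List S} (hlen : xs.length = n + 1)
    (hmem : ∀ x ∈ xs, x ∈ a.map (algebraMap R S)) (hreg : IsWeaklyRegular N xs) :
    Function.Injective (AlgebraTensorModule.lTensor S N (LinearMap.ker p).subtype) := by
  have hne : xs ≠ [] := by
    rintro rfl
    simp at hlen
  rw [← List.dropLast_append_getLast hne] at hreg hmem
  set ys := xs.dropLast with hys
  set z := xs.getLast hne
  rw [isWeaklyRegular_append_iff, isWeaklyRegular_singleton_iff] at hreg
  obtain ⟨f, hf⟩ := hT S N ys (by simp [hys, hlen]) (fun x hx => hmem x (by simp [hx])) hreg.1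
  rw [injective_iff_map_eq_zero]
  intro u hu
  have hkill : ∀ y ∈ a.map (algebraMap R S), y • u = 0 := fun y hy =>
    ker_lTensor_subtype_smul hK hp hu hy
  let u' : Submodule.torsionBySet S (N ⊗[R] LinearMap.ker p) {x | x ∈ ys} :=
    ⟨u, (Submodule.mem_torsionBySet_iff _ _).2 fun y => hkill y (hmem y (by simp [y.2.out]))⟩
  have hzu : z • u' = 0 := Subtype.ext (hkill z (hmem z (by simp)))
  -- The embedding lands in copies of N / ys N, where z acts injectively; but z kills u, as all of
  -- aS does.
  have hfu : f u' = 0 := by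
    funext i
    apply hreg.2
    have := congrFun ((f.map_smul z u').symm.trans (by rw [hzu, map_zero])) i
    simpa using this
  exact congrArg Subtype.val (hf (hfu.trans (map_zero f).symm))

end

end

/-! ### The snake lemma and base change of projective dimension -/

section

open TensorProduct RingTheory.Sequence CategoryTheory Pointwise

/-- This is the snake lemma for multiplication by x, with τ in the role of M' → M'/xM'. The
connecting map is injective because x is regular on the middle term. -/
lemma exists_connecting_linearMap {S M' M M'' Q : Type*} [CommRing S] [AddCommGroup M']
    [Module S M'] [AddCommGroup M] [Module S M] [AddCommGroup M''] [Module S M'']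
    [AddCommGroup Q] [Module S Q] {i : M' →ₗ[S] M} {p : M →ₗ[S] M''}
    (hi : Function.Injective i) (hip : Function.Exact i p) (hp : Function.Surjective p)
    {x : S} (hx : IsSMulRegular M x) (τ : M' →ₗ[S] Q) (hτ : ∀ w, τ w = 0 ↔ ∃ w', w = x • w') :
    ∃ δ : Submodule.torsionBy S M'' x →ₗ[S] Q, Function.Injective δ := by
  have ex : ∀ u : Submodule.torsionBy S M'' x, ∃ w m, p m = u ∧ i w = x • m := by
    rintro ⟨u, hu⟩
    obtain ⟨m, rfl⟩ := hp u
    rw [Submodule.mem_torsionBy_iff, ← map_smul] at hu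
    obtain ⟨w, hw⟩ := (hip _).1 hu
    exact ⟨w, m, rfl, hw⟩
  have uniq : ∀ (w w' : M') (m m' : M), p m = p m' → i w = x • m → i w' = x • m' →
      τ w = τ w' := by
    intro w w' m m' hm hw hw'
    obtain ⟨v, hv⟩ := (hip (m - m')).1 (by rw [map_sub, hm, sub_self])
    rw [← sub_eq_zero, ← map_sub, hτ]
    refine ⟨v, hi ?_⟩
    rw [map_sub, map_smul, hw, hw', hv, smul_sub]
  choose w m hm hw using ex
  refine ⟨{ toFun := fun u => τ (w u), map_add' := fun u v => ?_, map_smul' := fun c u => ?_ }, ?_⟩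
  · rw [← map_add]
    exact uniq _ _ (m (u + v)) (m u + m v) (by simp [hm]) (hw _) (by simp [hw])
  · rw [RingHom.id_apply, ← map_smul]
    exact uniq _ _ (m (c • u)) (c • m u) (by simp [hm]) (hw _) (by simp [hw, smul_comm c x])
  · rw [injective_iff_map_eq_zero]
    intro u hu
    obtain ⟨w', hw'⟩ := (hτ _).1 hu
    have h1 : x • m u = x • i w' := by rw [← hw, hw', map_smul]
    apply Subtype.ext
    rw [← hm, hx h1]
    exact hip.apply_apply_eq_zero w'

section

variable {R : Type u} [CommRing R] {a : Ideal R} {K : Type u} [AddCommGroup K] [Module R K]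

/-- Dimension shift: the x-torsion of N ⊗ K embeds into (N/xN) ⊗ ker p by the connecting map, and
the rest of the sequence is weakly regular on N/xN. This recursion is why N must be arbitrary; b
does not change. -/
lemma TorsionEmbeds.succ (hK : FactorsThroughProjective a K) {m : ℕ}
    {p : (Fin m → R) →ₗ[R] K} (hp : Function.Surjective p) {n b : ℕ}
    (hT : TorsionEmbeds a (LinearMap.ker p) n b) : TorsionEmbeds a K (n + 1) b := by
  intro S _ _ N _ _ _ _ xs hlen hmem hreg
  have hinj := hT.lTensor_subtype_injective hK hp hlen hmem hreg
  obtain _ | ⟨x, rs⟩ := xs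
  · simp at hlen
  simp only [List.length_cons, add_left_inj] at hlen
  rw [isWeaklyRegular_cons_iff] at hreg
  let τ : N ⊗[R] LinearMap.ker p →ₗ[S] QuotSMulTop x N ⊗[R] LinearMap.ker p :=
    AlgebraTensorModule.rTensor R (LinearMap.ker p) (Submodule.mkQ (x • ⊤ : Submodule S N))
  have hτ : ∀ w, τ w = 0 ↔ ∃ w', w = x • w' := by
    refine fun w => ⟨exists_smul_eq_of_rTensor_mk_eq_zero x _, ?_⟩
    rintro ⟨w', rfl⟩
    rw [map_smul]
    generalize τ w' = v
    induction v with
    | zero => simp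
    | add y z hy hz => rw [smul_add, hy, hz, add_zero]
    | tmul y z =>
      obtain ⟨y, rfl⟩ := Submodule.mkQ_surjective _ y
      rw [smul_tmul', ← map_smul, Submodule.mkQ_apply, (Submodule.Quotient.mk_eq_zero _).2,
        zero_tmul]
      exact Submodule.smul_mem_pointwise_smul _ _ _ trivial
  have hex : Function.Exact (AlgebraTensorModule.lTensor S N (LinearMap.ker p).subtype)
      (AlgebraTensorModule.lTensor S N p) :=
    lTensor_exact N (fun y => by simp) hp
  obtain ⟨δ, hδ⟩ := exists_connecting_linearMap hinj hex (LinearMap.lTensor_surjective N hp)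
    (isSMulRegular_tensor_fin_fun hreg.1 m) τ hτ
  obtain ⟨f, hf⟩ := hT S (QuotSMulTop x N) rs hlen (fun r hr => hmem r (by simp [hr])) hreg.2
  let T := Submodule.torsionBySet S (N ⊗[R] K) {y | y ∈ x :: rs}
  have hTx : T ≤ Submodule.torsionBy S (N ⊗[R] K) x := fun u hu => by
    rw [Submodule.mem_torsionBySet_iff] at hu
    exact (Submodule.mem_torsionBy_iff _ _).2 (hu ⟨x, by simp⟩)
  let δ' : T →ₗ[S] Submodule.torsionBySet S (QuotSMulTop x N ⊗[R] LinearMap.ker p)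
      {y | y ∈ rs} :=
    LinearMap.codRestrict _ (δ ∘ₗ Submodule.inclusion hTx) fun u => by
      rw [Submodule.mem_torsionBySet_iff]
      rintro ⟨r, hr⟩
      have hru : r • u = 0 := Subtype.ext
        ((Submodule.mem_torsionBySet_iff _ _).1 u.2 ⟨r, List.mem_cons_of_mem x hr⟩)
      rw [← map_smul, hru, map_zero]
  let e := (Submodule.quotOfListConsSMulTopEquivQuotSMulTopInner N x rs).symm
  let e' := LinearEquiv.piCongrRight fun _ : Fin b => e
  refine ⟨e'.toLinearMap ∘ₗ f ∘ₗ δ', e'.injective.comp (hf.comp ?_)⟩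
  intro u v huv
  exact Submodule.inclusion_injective hTx (hδ (congrArg Subtype.val huv))

lemma TorsionEmbeds.zero [Module.Finite R K] [Module.Projective R K] :
    ∃ b, TorsionEmbeds a K 0 b := by
  obtain ⟨b, p, hp⟩ := Module.Finite.exists_fin' R K
  obtain ⟨s, hs⟩ := Module.projective_lifting_property p LinearMap.id hp
  refine ⟨b, fun S _ _ N _ _ _ _ xs hlen hmem hreg => ?_⟩
  obtain rfl := List.length_eq_zero_iff.1 hlen
  let e : (N ⧸ (Ideal.ofList ([] : List S) • ⊤ : Submodule S N)) ≃ₗ[S] N :=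
    Submodule.quotEquivOfEqBot _ (by rw [Ideal.ofList_nil, Submodule.bot_smul])
  let e' := LinearEquiv.piCongrRight fun _ : Fin b => e.symm
  let e'' := TensorProduct.piScalarRight R S N (Fin b)
  have hinj : Function.Injective (AlgebraTensorModule.lTensor S N s) := by
    refine Function.LeftInverse.injective (g := AlgebraTensorModule.lTensor S N p) fun u => ?_
    rw [← LinearMap.comp_apply, ← AlgebraTensorModule.lTensor_comp, hs]
    simp
  exact ⟨e'.toLinearMap ∘ₗ e''.toLinearMap ∘ₗ
    AlgebraTensorModule.lTensor S N s ∘ₗ Submodule.subtype _, e'.injective.comp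
      (e''.injective.comp (hinj.comp (Submodule.subtype_injective _)))⟩

/-- Base change of a finite module of finite projective dimension `n` on which multiplication by
the elements of `a` factors through projectives, along a ring extension in which `a` still contains
a weakly regular sequence of length `n`. -/
theorem exists_torsionEmbeds_and_hasProjectiveDimensionLE [IsNoetherianRing R] (n : ℕ) (K : Type u)
    [AddCommGroup K] [Module R K] [Module.Finite R K] (hK : FactorsThroughProjective a K)
    (hpd : HasProjectiveDimensionLE (ModuleCat.of R K) n) :
    (∃ b, TorsionEmbeds a K n b) ∧
    ∀ (S : Type u) [CommRing S] [Algebra R S] (xs : List S), n ≤ xs.length →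
      (∀ x ∈ xs, x ∈ a.map (algebraMap R S)) → IsWeaklyRegular S xs →
      HasProjectiveDimensionLE (ModuleCat.of S (S ⊗[R] K)) n := by
  induction n generalizing K with
  | zero =>
    have : Module.Projective R K := by
      rw [IsProjective.iff_projective]
      exact (projective_iff_hasProjectiveDimensionLE_zero _).2 hpd
    refine ⟨TorsionEmbeds.zero, fun S _ _ _ _ _ _ => ?_⟩
    rw [← projective_iff_hasProjectiveDimensionLE_zero, ← IsProjective.iff_projective]
    infer_instance
  | succ n ih =>
    obtain ⟨m, p, hp⟩ := Module.Finite.exists_fin' R K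
    have hse := LinearMap.shortExact_shortComplexKer hp
    have hker : HasProjectiveDimensionLE (ModuleCat.of R (LinearMap.ker p)) n := by
      refine hse.hasProjectiveDimensionLT_X₁ (n + 1) ?_ hpd
      have : Projective (ModuleCat.of R (Fin m → R)) :=
        (IsProjective.iff_projective _).1 inferInstance
      exact hasProjectiveDimensionLT_of_ge (ModuleCat.of R (Fin m → R)) 1 _ (by lia)
    obtain ⟨⟨b, hT⟩, hS⟩ := ih (LinearMap.ker p) (hK.ker hp) hker
    refine ⟨⟨b, hT.succ hK hp⟩, fun S _ _ xs hlen hmem hreg => ?_⟩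
    -- Sequences longer than the projective dimension are allowed so that the same xs serves the
    -- syzygy; injectivity uses exactly n + 1 of its terms.
    have hreg' : IsWeaklyRegular S (xs.take (n + 1)) := by
      rw [← List.take_append_drop (n + 1) xs, isWeaklyRegular_append_iff] at hreg
      exact hreg.1
    have hinj := hT.lTensor_subtype_injective hK hp (xs := xs.take (n + 1)) (N := S)
      (by simpa using hlen) (fun x hx => hmem x (List.mem_of_mem_take hx)) hreg'
    have hex : Function.Exact (AlgebraTensorModule.lTensor S S (LinearMap.ker p).subtype)
        (AlgebraTensorModule.lTensor S S p) :=
      lTensor_exact S (fun y => by simp) hp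
    let C : ShortComplex (ModuleCat.{u} S) :=
      ShortComplex.mk (ModuleCat.ofHom (AlgebraTensorModule.lTensor S S (LinearMap.ker p).subtype))
        (ModuleCat.ofHom (AlgebraTensorModule.lTensor S S p))
        (by rw [← ModuleCat.ofHom_comp, hex.linearMap_comp_eq_zero]; rfl)
    have hC : C.ShortExact := ModuleCat.shortComplex_shortExact C hex hinj
      (LinearMap.lTensor_surjective S hp)
    refine hC.hasProjectiveDimensionLT_X₃ (n + 1) (hS S xs (by lia) hmem hreg) ?_
    have : Projective (ModuleCat.of S (S ⊗[R] (Fin m → R))) :=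
      (IsProjective.iff_projective _).1 inferInstance
    exact hasProjectiveDimensionLT_of_ge (ModuleCat.of S (S ⊗[R] (Fin m → R))) 1 _ (by lia)

end

end

/-! ### Finite-length submodules modulo powers of a regular sequence -/

section

open RingTheory.Sequence Pointwise

/-- Every submodule of finite length of `M` has length at most `c`. -/
def FiniteLengthBound (R : Type u) (M : Type v) [CommRing R] [AddCommGroup M] [Module R M]
    (c : ℕ) : Prop :=
  ∀ N : Submodule R M, Module.length R N ≠ ⊤ → Module.length R N ≤ c

section

variable {R : Type u} [CommRing R] {M : Type v} [AddCommGroup M] [Module R M]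

lemma FiniteLengthBound.length_le {c : ℕ} (h : FiniteLengthBound R M c) {T : Type w}
    [AddCommGroup T] [Module R T] (f : T →ₗ[R] M) (hf : Function.Injective f)
    (hT : Module.length R T ≠ ⊤) : Module.length R T ≤ c := by
  have e := (LinearEquiv.ofInjective f hf).length_eq
  rw [e] at hT ⊢
  exact h _ hT

lemma FiniteLengthBound.of_injective {c : ℕ} (h : FiniteLengthBound R M c) {T : Type w}
    [AddCommGroup T] [Module R T] (f : T →ₗ[R] M) (hf : Function.Injective f) :
    FiniteLengthBound R T c := fun N hN =>
  h.length_le (f ∘ₗ N.subtype) (hf.comp (Submodule.subtype_injective _)) hN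

lemma FiniteLengthBound.of_exact {M' M'' : Type*} [AddCommGroup M'] [Module R M']
    [AddCommGroup M''] [Module R M''] {i : M' →ₗ[R] M} {p : M →ₗ[R] M''}
    (hi : Function.Injective i) (hip : Function.Exact i p) {c' c'' : ℕ}
    (h' : FiniteLengthBound R M' c') (h'' : FiniteLengthBound R M'' c'') :
    FiniteLengthBound R M (c' + c'') := by
  intro N hN
  let f : N.comap i →ₗ[R] N := i.restrict fun x hx => hx
  let g : N →ₗ[R] N.map p := p.restrict fun x hx => Submodule.mem_map_of_mem hx
  have hf : Function.Injective f := fun x y hxy => Subtype.ext (hi (congrArg Subtype.val hxy))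
  have hg : Function.Surjective g := by
    rintro ⟨_, x, hx, rfl⟩
    exact ⟨⟨x, hx⟩, rfl⟩
  have hfg : Function.Exact f g := by
    rintro ⟨x, hx⟩
    constructor
    · intro h
      obtain ⟨y, rfl⟩ := (hip x).1 (congrArg Subtype.val h)
      exact ⟨⟨y, hx⟩, rfl⟩
    · rintro ⟨y, hy⟩
      apply Subtype.ext
      have : i y = x := congrArg Subtype.val hy
      change p x = 0
      rw [← this, hip.apply_apply_eq_zero]
  have hlen := Module.length_eq_add_of_exact f g hf hg hfg
  rw [hlen] at hN ⊢
  rw [ne_eq, ENat.add_eq_top, not_or] at hN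
  push_cast
  exact add_le_add (h' _ hN.1) (h'' _ hN.2)

lemma FiniteLengthBound.pi {c : ℕ} (h : FiniteLengthBound R M c) (b : ℕ) :
    FiniteLengthBound R (Fin b → M) (b * c) := by
  intro N hN
  let N' (i : Fin b) : Submodule R M := N.map (LinearMap.proj i)
  let g (i : Fin b) : N →ₗ[R] N' i :=
    (LinearMap.proj i).restrict fun x hx => Submodule.mem_map_of_mem hx
  have hg (i : Fin b) : Function.Surjective (g i) := by
    rintro ⟨_, x, hx, rfl⟩
    exact ⟨⟨x, hx⟩, rfl⟩
  have hinj : Function.Injective (LinearMap.pi g) := fun x y hxy =>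
    Subtype.ext (funext fun i => congrArg Subtype.val (congrFun hxy i))
  calc Module.length R N ≤ Module.length R (Π i, N' i) :=
        Module.length_le_of_injective _ hinj
    _ = ∑ i, Module.length R (N' i) := Module.length_pi_of_fintype _ _
    _ ≤ ∑ _i : Fin b, (c : ℕ∞) := Finset.sum_le_sum fun i _ =>
        h _ (ne_top_of_le_ne_top hN (Module.length_le_of_surjective (g i) (hg i)))
    _ = ((b * c : ℕ) : ℕ∞) := by simp

/-- A maximal submodule of finite length contains all others, since the sum of two is again of
finite length. This replaces the length of M / rs M, which may be infinite. -/
lemma exists_finiteLengthBound [IsNoetherian R M] : ∃ c, FiniteLengthBound R M c := by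
  obtain ⟨N₀, h₀, hmax⟩ := set_has_maximal_iff_noetherian.2 ‹IsNoetherian R M›
    {N : Submodule R M | Module.length R N ≠ ⊤} ⟨⊥, by simp⟩
  obtain ⟨c, hc⟩ := ENat.ne_top_iff_exists.1 h₀
  refine ⟨c, fun N hN => ?_⟩
  have hsup : Module.length R ↥(N₀ ⊔ N) ≠ ⊤ := by
    have hr : LinearMap.range (N₀.subtype.coprod N.subtype) = N₀ ⊔ N := by
      rw [LinearMap.range_coprod, Submodule.range_subtype, Submodule.range_subtype]
    rw [← hr]
    refine ne_top_of_le_ne_top ?_ (Module.length_le_of_surjective _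
      (N₀.subtype.coprod N.subtype).surjective_rangeRestrict)
    rw [Module.length_prod, ne_eq, ENat.add_eq_top, not_or]
    exact ⟨h₀, hN⟩
  have hle : N ≤ N₀ := by
    by_contra hcon
    exact hmax _ hsup (left_lt_sup.2 hcon)
  rw [hc]
  exact Module.length_le_of_injective _ (Submodule.inclusion_injective hle)

end

section

variable {R : Type u} [CommRing R]

/-- Weakly regular sequences, and bounds on lengths of submodules of the quotients by them, are
stable under extensions. -/
lemma isWeaklyRegular_and_finiteLengthBound_of_exact (rs : List R) {M' M M'' : Type v}
    [AddCommGroup M'] [Module R M'] [AddCommGroup M] [Module R M]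
    [AddCommGroup M''] [Module R M''] {i : M' →ₗ[R] M} {p : M →ₗ[R] M''}
    (hi : Function.Injective i) (hip : Function.Exact i p) (hp : Function.Surjective p)
    (h' : IsWeaklyRegular M' rs) (h'' : IsWeaklyRegular M'' rs) :
    IsWeaklyRegular M rs ∧ ∀ c' c'' : ℕ,
      FiniteLengthBound R (M' ⧸ (Ideal.ofList rs • ⊤ : Submodule R M')) c' →
      FiniteLengthBound R (M'' ⧸ (Ideal.ofList rs • ⊤ : Submodule R M'')) c'' →
      FiniteLengthBound R (M ⧸ (Ideal.ofList rs • ⊤ : Submodule R M)) (c' + c'') := by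
  induction rs generalizing M' M M'' with
  | nil =>
    refine ⟨.nil _ _, fun c' c'' hc' hc'' => ?_⟩
    let e (X : Type v) [AddCommGroup X] [Module R X] :
        (X ⧸ (Ideal.ofList ([] : List R) • ⊤ : Submodule R X)) ≃ₗ[R] X :=
      Submodule.quotEquivOfEqBot _ (by rw [Ideal.ofList_nil, Submodule.bot_smul])
    refine FiniteLengthBound.of_injective ?_ (e M).toLinearMap (e M).injective
    exact .of_exact hi hip (hc'.of_injective (e M').symm.toLinearMap (e M').symm.injective)
      (hc''.of_injective (e M'').symm.toLinearMap (e M'').symm.injective)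
  | cons r rs ih =>
    rw [isWeaklyRegular_cons_iff] at h' h''
    have hr : IsSMulRegular M r :=
      isSMulRegular_of_range_eq_ker hi (LinearMap.exact_iff.1 hip).symm h'.1 h''.1
    have hzero : Function.Exact (0 : PUnit →ₗ[R] M') i := by
      rw [LinearMap.exact_zero_iff_injective]
      exact hi
    -- Regularity of r on M'' is the vanishing of Tor_1(R/r, M'') in elementary form, so reduction
    -- modulo r keeps the sequence left exact.
    have hi' : Function.Injective (QuotSMulTop.map r i) := by
      have := QuotSMulTop.map_first_exact_on_four_term_exact_of_isSMulRegular_last hzero hip h''.1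
      rw [map_zero, LinearMap.exact_zero_iff_injective] at this
      exact this
    obtain ⟨h1, h2⟩ := ih hi' (QuotSMulTop.map_exact r hip hp) (QuotSMulTop.map_surjective r hp)
      h'.2 h''.2
    refine ⟨(isWeaklyRegular_cons_iff _ _ _).2 ⟨hr, h1⟩, fun c' c'' hc' hc'' => ?_⟩
    let e (X : Type v) [AddCommGroup X] [Module R X] :=
      Submodule.quotOfListConsSMulTopEquivQuotSMulTopInner X r rs
    refine FiniteLengthBound.of_injective ?_ (e M).toLinearMap (e M).injective
    exact h2 _ _ (hc'.of_injective (e M').symm.toLinearMap (e M').symm.injective)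
      (hc''.of_injective (e M'').symm.toLinearMap (e M'').symm.injective)

lemma isWeaklyRegular_and_finiteLengthBound_of_subsingleton (rs : List R) (M : Type v)
    [AddCommGroup M] [Module R M] [Subsingleton M] :
    IsWeaklyRegular M rs ∧
      FiniteLengthBound R (M ⧸ (Ideal.ofList rs • ⊤ : Submodule R M)) 0 :=
  ⟨⟨fun _ _ _ _ _ => Subsingleton.elim _ _⟩, fun N _ => by simp⟩

/-- Induction on s along 0 → M/r^s M → M/r^(s+1) M → M/rM → 0, whose first map is multiplication by
r; each step adds c to the bound. -/
lemma isWeaklyRegular_and_finiteLengthBound_quotSMulTop_pow {r : R} {rs : List R} {M : Type v}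
    [AddCommGroup M] [Module R M] (hr : IsSMulRegular M r)
    (hrs : IsWeaklyRegular (QuotSMulTop r M) rs) {c : ℕ}
    (hc : FiniteLengthBound R (QuotSMulTop r M ⧸
      (Ideal.ofList rs • ⊤ : Submodule R (QuotSMulTop r M))) c) (s : ℕ) :
    IsWeaklyRegular (QuotSMulTop (r ^ s) M) rs ∧
      FiniteLengthBound R (QuotSMulTop (r ^ s) M ⧸
        (Ideal.ofList rs • ⊤ : Submodule R (QuotSMulTop (r ^ s) M))) (s * c) := by
  induction s with
  | zero =>
    have : Subsingleton (QuotSMulTop (r ^ 0) M) := by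
      rw [Submodule.Quotient.subsingleton_iff, pow_zero, one_smul]
    rw [zero_mul]
    exact isWeaklyRegular_and_finiteLengthBound_of_subsingleton _ _
  | succ s ih =>
    let i : QuotSMulTop (r ^ s) M →ₗ[R] QuotSMulTop (r ^ (s + 1)) M :=
      Submodule.mapQ _ _ (LinearMap.lsmul R M r) fun x hx => by
        obtain ⟨y, -, rfl⟩ := (Submodule.mem_smul_pointwise_iff_exists _ _ _).1 hx
        exact (Submodule.mem_smul_pointwise_iff_exists _ _ _).2
          ⟨y, trivial, by rw [pow_succ', mul_smul]; rfl⟩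
    let p : QuotSMulTop (r ^ (s + 1)) M →ₗ[R] QuotSMulTop r M :=
      Submodule.factor fun x hx => by
        obtain ⟨y, -, rfl⟩ := (Submodule.mem_smul_pointwise_iff_exists _ _ _).1 hx
        rw [pow_succ', mul_smul]
        exact Submodule.smul_mem_pointwise_smul _ _ _ trivial
    have hi : Function.Injective i := by
      rw [injective_iff_map_eq_zero]
      intro x hx
      obtain ⟨x, rfl⟩ := Submodule.mkQ_surjective _ x
      have hx' : r • x ∈ r ^ (s + 1) • (⊤ : Submodule R M) :=
        (Submodule.Quotient.mk_eq_zero _).1 hx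
      obtain ⟨y, -, hy⟩ := (Submodule.mem_smul_pointwise_iff_exists _ _ _).1 hx'
      rw [pow_succ', mul_smul] at hy
      rw [← hr hy]
      exact (Submodule.Quotient.mk_eq_zero _).2 (Submodule.smul_mem_pointwise_smul _ _ _ trivial)
    have hp : Function.Surjective p := Submodule.factor_surjective _
    have hip : Function.Exact i p := by
      intro x
      obtain ⟨x, rfl⟩ := Submodule.mkQ_surjective _ x
      constructor
      · intro hx
        have hx' : x ∈ r • (⊤ : Submodule R M) := (Submodule.Quotient.mk_eq_zero _).1 hx
        obtain ⟨y, -, rfl⟩ := (Submodule.mem_smul_pointwise_iff_exists _ _ _).1 hx'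
        exact ⟨Submodule.mkQ _ y, rfl⟩
      · rintro ⟨y, hy⟩
        obtain ⟨y, rfl⟩ := Submodule.mkQ_surjective _ y
        rw [← hy]
        exact (Submodule.Quotient.mk_eq_zero _).2 (Submodule.smul_mem_pointwise_smul _ _ _ trivial)
    obtain ⟨h1, h2⟩ := isWeaklyRegular_and_finiteLengthBound_of_exact rs hi hip hp ih.1 hrs
    refine ⟨h1, ?_⟩
    rw [add_mul, one_mul]
    exact h2 _ _ ih.2 hc

/-- If `rs` is weakly regular on `M`, then so are the powers `rs ^ s`, and the lengths of
submodules of finite length of `M / rs ^ s M` grow at most like `s ^ rs.length`. -/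
theorem isWeaklyRegular_and_finiteLengthBound_map_pow (rs : List R) {M : Type v}
    [AddCommGroup M] [Module R M] (hrs : IsWeaklyRegular M rs) {c : ℕ}
    (hc : FiniteLengthBound R (M ⧸ (Ideal.ofList rs • ⊤ : Submodule R M)) c) (s : ℕ) :
    IsWeaklyRegular M (rs.map (· ^ s)) ∧
      FiniteLengthBound R (M ⧸ (Ideal.ofList (rs.map (· ^ s)) • ⊤ : Submodule R M))
        (s ^ rs.length * c) := by
  induction rs generalizing M c with
  | nil =>
    refine ⟨.nil _ _, ?_⟩
    rw [List.length_nil, pow_zero, one_mul]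
    exact hc
  | cons r rs ih =>
    rw [isWeaklyRegular_cons_iff] at hrs
    let e := Submodule.quotOfListConsSMulTopEquivQuotSMulTopInner M r rs
    obtain ⟨h1, h2⟩ := isWeaklyRegular_and_finiteLengthBound_quotSMulTop_pow hrs.1 hrs.2
      (hc.of_injective e.symm.toLinearMap e.symm.injective) s
    obtain ⟨h3, h4⟩ := ih h1 h2
    let e' := Submodule.quotOfListConsSMulTopEquivQuotSMulTopInner M (r ^ s) (rs.map (· ^ s))
    refine ⟨(isWeaklyRegular_cons_iff _ _ _).2 ⟨hrs.1.pow s, h3⟩, ?_⟩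
    rw [List.length_cons, pow_succ, mul_assoc]
    exact h4.of_injective e'.toLinearMap e'.injective

end

end

/-! ### Growth of the Hilbert–Samuel function -/

section

open IsLocalRing

section

variable {B : Type u} [CommRing B]

/-- The submodule x(B/I) surjects onto B/J, and its cokernel B/(I + xB) surjects onto B/J'. -/
lemma length_quotient_add_length_quotient_le {I J J' : Ideal B} {x : B}
    (hJ : ∀ u, x * u ∈ I → u ∈ J) (hI : I ≤ J') (hx : x ∈ J') :
    Module.length B (B ⧸ J) + Module.length B (B ⧸ J') ≤ Module.length B (B ⧸ I) := by
  let φ : B →ₗ[B] B ⧸ I := I.mkQ ∘ₗ LinearMap.lsmul B B x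
  have hker : LinearMap.ker φ ≤ J := fun u hu =>
    hJ u ((Submodule.Quotient.mk_eq_zero I).1 hu)
  rw [Module.length_eq_add_of_exact (LinearMap.range φ).subtype (LinearMap.range φ).mkQ
    (Submodule.subtype_injective _) (Submodule.mkQ_surjective _)
    (LinearMap.exact_subtype_mkQ _), ← φ.quotKerEquivRange.length_eq]
  refine add_le_add (Module.length_le_of_surjective _ (Submodule.factor_surjective hker)) ?_
  have hle : LinearMap.range φ ≤ LinearMap.ker (Submodule.factor hI) := by
    rintro _ ⟨u, rfl⟩
    exact (Submodule.Quotient.mk_eq_zero J').2 (J'.mul_mem_right u hx)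
  refine Module.length_le_of_surjective ((LinearMap.range φ).liftQ _ hle) ?_
  intro y
  obtain ⟨z, rfl⟩ := Submodule.factor_surjective hI y
  exact ⟨Submodule.mkQ _ z, rfl⟩

lemma mk_mem_smul_top_iff (p I : Ideal B) (u : B) :
    p.mkQ u ∈ (I • ⊤ : Submodule B (B ⧸ p)) ↔ u ∈ p ⊔ I := by
  have : (I • ⊤ : Submodule B (B ⧸ p)) = Submodule.map p.mkQ I := by
    rw [← Submodule.range_mkQ p, ← Submodule.map_top, ← Submodule.map_smul'', smul_eq_mul,
      Ideal.mul_top]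
  rw [this, ← Submodule.mem_comap, Submodule.comap_map_mkQ]

/-- Artin–Rees for x(B/p) inside B/p, combined with injectivity of multiplication by x on the domain
B/p. -/
lemma exists_mem_sup_pow_of_mul_mem_sup_pow [IsNoetherianRing B] (m : Ideal B) {p : Ideal B}
    [p.IsPrime] {x : B} (hx : x ∉ p) :
    ∃ k, ∀ n u, x * u ∈ p ⊔ m ^ n → u ∈ p ⊔ m ^ (n - k) := by
  let f : (B ⧸ p) →ₗ[B] (B ⧸ p) := LinearMap.lsmul B (B ⧸ p) x
  have hf : Function.Injective f := by
    rw [injective_iff_map_eq_zero]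
    intro u hu
    obtain ⟨u, rfl⟩ := Ideal.Quotient.mk_surjective u
    have h : Ideal.Quotient.mk p (x * u) = 0 := hu
    rw [Ideal.Quotient.eq_zero_iff_mem] at h ⊢
    exact (Ideal.IsPrime.mem_or_mem ‹_› h).resolve_left hx
  obtain ⟨k, hk⟩ := Ideal.exists_pow_inf_eq_pow_smul m (LinearMap.range f)
  refine ⟨k, fun n u hu => ?_⟩
  rcases lt_or_ge n k with h | h
  · simp [Nat.sub_eq_zero_of_le h.le]
  rw [← mk_mem_smul_top_iff] at hu ⊢
  have h1 : f (p.mkQ u) ∈ m ^ n • ⊤ ⊓ LinearMap.range f := ⟨hu, _, rfl⟩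
  rw [hk n h] at h1
  have hle : m ^ (n - k) • (m ^ k • ⊤ ⊓ LinearMap.range f) ≤ m ^ (n - k) • LinearMap.range f :=
    smul_mono_right _ inf_le_right
  have h2 := hle h1
  rw [← Submodule.map_top, ← Submodule.map_smul''] at h2
  obtain ⟨w, hw, hw'⟩ := h2
  rwa [← hf hw']

/-- Lower bound for the Hilbert-Samuel function of a Noetherian local ring. -/
theorem exists_choose_le_length_quotient [IsNoetherianRing B] [IsLocalRing B] (h : ℕ)
    (q : LTSeries (PrimeSpectrum B)) (hq : q.length = h) :
    ∃ k, ∀ n, (n.choose h : ℕ∞) ≤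
      Module.length B (B ⧸ (q.head.asIdeal ⊔ maximalIdeal B ^ (k * n + 1))) := by
  induction h generalizing q with
  | zero =>
    refine ⟨0, fun n => ?_⟩
    rw [Nat.choose_zero_right, Nat.cast_one, Order.one_le_iff_ne_zero, ne_eq,
      Module.length_eq_zero_iff, Submodule.Quotient.subsingleton_iff, zero_mul, zero_add, pow_one,
      sup_eq_right.2 (le_maximalIdeal q.head.2.ne_top)]
    exact (maximalIdeal.isMaximal B).ne_top
  | succ h ih =>
    have hne : q.length ≠ 0 := by lia
    obtain ⟨k₁, hk₁⟩ := ih (q.tail hne) (by simp [hq])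
    have hlt : q.head < (q.tail hne).head := by
      rw [RelSeries.head_tail]
      exact q.strictMono (by simp [Fin.lt_def, hq])
    obtain ⟨x, hx, hxq⟩ := SetLike.exists_of_lt (show q.head.asIdeal < (q.tail hne).head.asIdeal from hlt)
    obtain ⟨k₂, hk₂⟩ := exists_mem_sup_pow_of_mul_mem_sup_pow (maximalIdeal B) hxq
    -- At least k₂, so that one step in n absorbs the Artin–Rees shift; at least k₁, so that the
    -- bound for the shorter chain applies. Pascal's identity then closes the induction on n.
    refine ⟨max k₁ k₂, fun n => ?_⟩
    induction n with
    | zero => simp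
    | succ n ihn =>
      have hle : q.head.asIdeal ⊔ maximalIdeal B ^ (max k₁ k₂ * (n + 1) + 1 - k₂) ≤
          q.head.asIdeal ⊔ maximalIdeal B ^ (max k₁ k₂ * n + 1) := by
        refine sup_le_sup_left (Ideal.pow_le_pow_right ?_) _
        have := le_max_right k₁ k₂
        rw [mul_add]
        lia
      have key := length_quotient_add_length_quotient_le
        (I := q.head.asIdeal ⊔ maximalIdeal B ^ (max k₁ k₂ * (n + 1) + 1))
        (J := q.head.asIdeal ⊔ maximalIdeal B ^ (max k₁ k₂ * n + 1))
        (J' := (q.tail hne).head.asIdeal ⊔ maximalIdeal B ^ (k₁ * n + 1)) (x := x)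
        (fun u hu => hle (hk₂ _ u hu))
        (sup_le_sup hlt.le (Ideal.pow_le_pow_right (by
          have := le_max_left k₁ k₂
          gcongr
          lia)))
        (Ideal.mem_sup_left hx)
      refine le_trans ?_ key
      rw [Nat.choose_succ_succ, add_comm, Nat.cast_add]
      exact add_le_add ihn (hk₁ n)

end

end

/-! ### Comparing the derived functor `Ext` with `Abelian.Ext` -/

section

open CategoryTheory Limits Opposite

section

variable {R : Type u} [CommRing R]

theorem isZero_Ext_iff_subsingleton (X Y : ModuleCat.{u} R) (m : ℕ) :
    IsZero (((Ext R (ModuleCat.{u} R) (m + 1)).obj (op X)).obj Y) ↔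
      Subsingleton (Abelian.Ext X Y (m + 1)) := by
  let P := projectiveResolution X
  rw [(P.isoExt (R := R) (m + 1) Y).isZero_iff, ← HomologicalComplex.exactAt_iff_isZero_homology,
    HomologicalComplex.exactAt_iff' _ m (m + 1) (m + 2) (by simp) (by simp),
    ShortComplex.moduleCat_exact_iff]
  constructor
  · intro h
    refine subsingleton_of_forall_eq 0 fun α => ?_
    obtain ⟨f, hf, rfl⟩ := P.extMk_surjective α (m + 2) rfl
    rw [P.extMk_eq_zero_iff _ _ _ _ m rfl]
    exact h f hf
  · intro h f hf
    exact (P.extMk_eq_zero_iff f (m + 2) rfl hf m rfl).mp (Subsingleton.elim _ _)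

theorem mono_homologyMap_of_forall {K L : CochainComplex (ModuleCat.{u} R) ℕ} (φ : K ⟶ L) (m : ℕ)
    (h : ∀ x : K.X (m + 1), K.d (m + 1) (m + 2) x = 0 → ∀ y : L.X m,
      φ.f (m + 1) x = L.d m (m + 1) y → ∃ z : K.X m, x = K.d m (m + 1) z) :
    Mono (HomologicalComplex.homologyMap φ (m + 1)) := by
  rw [HomologicalComplex.mono_homologyMap_iff_up_to_refinements φ m (m + 1) (m + 2)
    (by simp) (by simp)]
  intro A x hx y hy
  choose z hz using fun a : A => h (x a) (LinearMap.congr_fun (congrArg ModuleCat.Hom.hom hx) a)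
    (y a) (LinearMap.congr_fun (congrArg ModuleCat.Hom.hom hy) a)
  -- The chosen z need not be linear in a, so it is extended linearly from the free module on the
  -- set A, which covers A.
  refine ⟨ModuleCat.of R (A →₀ R), ModuleCat.ofHom (Finsupp.linearCombination R id), ?_,
    ModuleCat.ofHom (Finsupp.linearCombination R z), ?_⟩
  · rw [ModuleCat.epi_iff_surjective]
    exact Finsupp.linearCombination_id_surjective R A
  · ext a
    simpa using hz a

theorem epi_homologyMap_op {K L : CochainComplex (ModuleCat.{u} R) ℕ} (φ : K ⟶ L) (i : ℕ)
    [Mono (HomologicalComplex.homologyMap φ i)] :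
    Epi (HomologicalComplex.homologyMap ((HomologicalComplex.opFunctor _ _).map φ.op) i) := by
  have nat := HomologicalComplex.homologyOp_hom_naturality φ i
  have h : Epi ((L.homologyOp i).hom ≫ (HomologicalComplex.homologyMap φ i).op) := inferInstance
  have e := (Iso.eq_comp_inv (K.homologyOp i)).mpr nat
  exact e ▸ epi_comp' h (@IsIso.epi_of_iso _ _ _ _ _ (Iso.isIso_inv _))

theorem mono_Ext_map_app_of_injective {X X' : ModuleCat.{u} R} (g : X' ⟶ X) (Y : ModuleCat.{u} R)
    (m : ℕ) (hg : ∀ α : Abelian.Ext X Y (m + 1),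
      (Abelian.Ext.mk₀ g).comp α (zero_add _) = 0 → α = 0) :
    Mono (((Ext R (ModuleCat.{u} R) (m + 1)).map g.op).app Y) := by
  let F := ((linearYoneda R (ModuleCat.{u} R)).obj Y).rightOp
  change Mono ((F.leftDerived (m + 1)).map g).unop
  suffices Epi ((F.leftDerived (m + 1)).map g) from inferInstance
  let P := projectiveResolution X
  let P' := projectiveResolution X'
  let φ : ProjectiveResolution.Hom P' P g := ⟨ProjectiveResolution.lift g P' P, by
    exact HomologicalComplex.congr_hom (ProjectiveResolution.lift_commutes g P' P) 0⟩
  have key := ProjectiveResolution.isoLeftDerivedObj_hom_naturality g P' P φ.hom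
    φ.hom_f_zero_comp_π_f_zero F (m + 1)
  suffices Epi ((F.mapHomologicalComplex _ ⋙
      HomologicalComplex.homologyFunctor _ _ (m + 1)).map φ.hom) by
    rw [← cancel_mono (P.isoLeftDerivedObj F (m + 1)).inv] at key
    simp only [Category.assoc, Iso.hom_inv_id, Category.comp_id] at key
    rw [key]
    infer_instance
  have hcoc (x : P.complex.X (m + 1) ⟶ Y) (hx : P.complex.d (m + 2) (m + 1) ≫ x = 0)
      (y : P'.complex.X m ⟶ Y) (hy : φ.hom.f (m + 1) ≫ x = P'.complex.d (m + 1) m ≫ y) :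
      ∃ z, P.complex.d (m + 1) m ≫ z = x := by
    rw [← P.extMk_eq_zero_iff x (m + 2) rfl hx m rfl]
    refine hg _ ?_
    rw [ProjectiveResolution.mk₀_comp_extMk _ _ _ _ φ, P'.extMk_eq_zero_iff _ _ _ _ m rfl]
    exact ⟨y, hy.symm⟩
  let K := P.complex.linearYonedaObj R Y
  let K' := P'.complex.linearYonedaObj R Y
  let ψ : K ⟶ K' := (HomologicalComplex.unopFunctor _ _).map
    ((F.mapHomologicalComplex _).map φ.hom).op
  have hψ : Mono (HomologicalComplex.homologyMap ψ (m + 1)) := by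
    refine mono_homologyMap_of_forall ψ m fun x hx y hy => ?_
    obtain ⟨z, hz⟩ := hcoc x hx y hy
    exact ⟨z, hz.symm⟩
  exact epi_homologyMap_op ψ (m + 1)

end

end

/-! ### Vanishing and nonvanishing of local cohomology -/

section

open CategoryTheory Limits Opposite

section

variable {R : Type u} [CommRing R]

/-- The surjection `R ⧸ J ⟶ R ⧸ I` for `J ≤ I`, in the category of modules. -/
def quotientFactor {J I : Ideal R} (h : J ≤ I) :
    ModuleCat.of R (R ⧸ J) ⟶ ModuleCat.of R (R ⧸ I) :=
  ModuleCat.ofHom (Submodule.mapQ J I LinearMap.id h)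

theorem quotientFactor_comp {I J K : Ideal R} (h : J ≤ I) (h' : K ≤ J) :
    quotientFactor h' ≫ quotientFactor h = quotientFactor (h'.trans h) := by
  ext
  rfl

/-- The colimit cocone computing `H_I^i(M)`. -/
noncomputable def localCohomologyIsColimit (I : Ideal R) (i : ℕ) (M : ModuleCat.{u} R) :
    IsColimit (((evaluation _ _).obj M).mapCocone
      (colimit.cocone (localCohomology.diagram (localCohomology.idealPowersDiagram I) i))) :=
  isColimitOfPreserves ((evaluation _ _).obj M) (colimit.isColimit _)

theorem isZero_localCohomology_of_cofinal (I : Ideal R) (m : ℕ) (M : ModuleCat.{u} R)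
    (h : ∀ t : ℕ, ∃ (s : ℕ) (J : Ideal R), I ^ s ≤ J ∧ J ≤ I ^ t ∧
      Subsingleton (Abelian.Ext (ModuleCat.of R (R ⧸ J)) M (m + 1))) :
    IsZero ((localCohomology I (m + 1)).obj M) := by
  rw [IsZero.iff_id_eq_zero]
  refine (localCohomologyIsColimit I (m + 1) M).hom_ext fun j => ?_
  set c := ((evaluation _ _).obj M).mapCocone
      (colimit.cocone (localCohomology.diagram (localCohomology.idealPowersDiagram I) (m + 1)))
  suffices c.ι.app j = 0 from
    (congrArg (· ≫ 𝟙 c.pt) this).trans (zero_comp.trans comp_zero.symm)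
  obtain ⟨s, J, hs, ht, hJ⟩ := h j.unop.unop
  -- The exponent is raised so that a transition map out of stage j exists; it factors through the
  -- vanishing Ext of R/J.
  have hle : I ^ (s + j.unop.unop) ≤ J := (Ideal.pow_le_pow_right (Nat.le_add_right _ _)).trans hs
  let f : j ⟶ op (op (s + j.unop.unop)) := (homOfLE (Nat.le_add_left _ _)).op.op
  have hf : (localCohomology.diagram (localCohomology.idealPowersDiagram I) (m + 1) ⋙
      (evaluation _ _).obj M).map f =
        ((Ext R (ModuleCat.{u} R) (m + 1)).map (quotientFactor ht).op).app M ≫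
        ((Ext R (ModuleCat.{u} R) (m + 1)).map (quotientFactor hle).op).app M := by
    rw [← NatTrans.comp_app, ← Functor.map_comp, ← op_comp, quotientFactor_comp]
    rfl
  have hz := (isZero_Ext_iff_subsingleton (ModuleCat.of R (R ⧸ J)) M m).mpr hJ
  have hf0 := hf.trans (((_ ≫= hz.eq_of_src _ 0)).trans comp_zero)
  exact (c.w f).symm.trans ((congrArg (· ≫ c.ι.app _) hf0).trans zero_comp)

/-- A class that dies in the filtered colimit already dies in Ext of some R/I^k, which injectivity
forbids unless it is zero. -/
theorem not_isZero_localCohomology_of_injective (I : Ideal R) (m : ℕ) (M : ModuleCat.{u} R)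
    (h : ¬ Subsingleton (Abelian.Ext (ModuleCat.of R (R ⧸ I)) M (m + 1)))
    (hinj : ∀ (J : Ideal R) (hJ : J ≤ I), (∃ k, I ^ k ≤ J) →
      ∀ α : Abelian.Ext (ModuleCat.of R (R ⧸ I)) M (m + 1),
        (Abelian.Ext.mk₀ (quotientFactor hJ)).comp α (zero_add _) = 0 → α = 0) :
    ¬ IsZero ((localCohomology I (m + 1)).obj M) := by
  intro hzero
  rw [← isZero_Ext_iff_subsingleton] at h
  apply h
  have h1 : I ^ 1 ≤ I := (pow_one I).le
  suffices IsZero (((Ext R (ModuleCat.{u} R) (m + 1)).obj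
      (op (ModuleCat.of R (R ⧸ I)))).obj M) from this
  rw [IsZero.iff_id_eq_zero]
  ext x
  let y := (((Ext R (ModuleCat.{u} R) (m + 1)).map (quotientFactor h1).op).app M) x
  let hc := localCohomologyIsColimit I (m + 1) M
  have : PreservesFilteredColimitsOfSize.{0, 0} (forget (ModuleCat.{u} R)) :=
    preservesFilteredColimitsOfSize_shrink.{0, u, 0, u} _
  have : PreservesColimitsOfShape ℕᵒᵖᵒᵖ (forget (ModuleCat.{u} R)) :=
    PreservesFilteredColimitsOfSize.preserves_filtered_colimits _
  obtain ⟨k, f, g, hfg⟩ := Concrete.isColimit_exists_of_rep_eq _ hc (i := op (op 1))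
    (j := op (op 1)) y 0 (by
      have := hzero.eq_of_tgt ((((evaluation _ _).obj M).mapCocone (colimit.cocone
        (localCohomology.diagram (localCohomology.idealPowersDiagram I) (m + 1)))).ι.app
          (op (op 1))) 0
      rw [this]
      rfl)
  rw [map_zero] at hfg
  have hk : I ^ k.unop.unop ≤ I ^ 1 := Ideal.pow_le_pow_right f.unop.unop.down.down
  have hmono : Mono (((Ext R (ModuleCat.{u} R) (m + 1)).map
      (quotientFactor (hk.trans h1)).op).app M) :=
    mono_Ext_map_app_of_injective _ _ _ (hinj _ (hk.trans h1) ⟨_, le_rfl⟩)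
  rw [ModuleCat.mono_iff_injective] at hmono
  apply hmono
  rw [← quotientFactor_comp h1 hk, op_comp, Functor.map_comp, NatTrans.comp_app]
  exact hfg.trans (map_zero _).symm

theorem support_subset_zeroLocus_of_pow_smul_eq_zero {N : Type*} [AddCommGroup N] [Module R N]
    [Module.Finite R N] (I : Ideal R) (k : ℕ) (h : I ^ k ≤ Module.annihilator R N) :
    Module.support R N ⊆ PrimeSpectrum.zeroLocus I := by
  rw [Module.support_eq_zeroLocus]
  intro p hp x hx
  exact p.2.mem_of_pow_mem k (hp (h (Ideal.pow_mem_pow hx k)))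

/-- In the long exact sequence of 0 → I/J → R/J → R/I → 0, the obstruction lies in Ext^m(I/J, R). It
vanishes because I/J is supported on V(I) and I contains a regular sequence longer than m. -/
theorem ext_eq_zero_of_quotientFactor_comp_eq_zero [IsNoetherianRing R] (I : Ideal R)
    (hI : I ≠ ⊤) (rs : List R) (hmem : ∀ r ∈ rs, r ∈ I)
    (hreg : RingTheory.Sequence.IsRegular R rs) (m : ℕ) (hm : rs.length = m + 1)
    (J : Ideal R) (hJ : J ≤ I) (hk : ∃ k, I ^ k ≤ J)
    (α : Abelian.Ext (ModuleCat.of R (R ⧸ I)) (ModuleCat.of R R) (m + 1))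
    (hα : (Abelian.Ext.mk₀ (quotientFactor hJ)).comp α (zero_add _) = 0) : α = 0 := by
  obtain ⟨k, hk⟩ := hk
  let q := Submodule.mapQ J I LinearMap.id hJ
  let S : ShortComplex (ModuleCat.{u} R) := ShortComplex.mk
    (ModuleCat.ofHom (LinearMap.ker q).subtype) (quotientFactor hJ)
    (by ext x; exact x.2)
  have hS : S.ShortExact :=
    { exact := by
        rw [ShortComplex.moduleCat_exact_iff]
        exact fun x hx => ⟨⟨x, hx⟩, rfl⟩
      mono_f := by
        rw [ModuleCat.mono_iff_injective]
        exact Subtype.val_injective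
      epi_g := by
        rw [ModuleCat.epi_iff_surjective]
        exact Submodule.factor_surjective hJ }
  obtain ⟨β, rfl⟩ := Abelian.Ext.contravariant_sequence_exact₃ hS _ α hα (add_comm 1 m)
  have hsub := ModuleCat.subsingleton_ext_of_exists_isRegular I
    (ModuleCat.of R (LinearMap.ker q))
    (support_subset_zeroLocus_of_pow_smul_eq_zero I k (hk.trans fun r hr => by
      rw [Module.mem_annihilator]
      rintro ⟨x, hx⟩
      obtain ⟨x, rfl⟩ := Submodule.mkQ_surjective _ x
      ext
      exact (Submodule.Quotient.mk_eq_zero _).mpr (J.mul_mem_right x hr)))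
    (ModuleCat.of R R) (by simpa [lt_top_iff_ne_top] using hI) rs hmem hreg m (by omega)
  rw [hsub.elim β 0, Abelian.Ext.comp_zero]

/-- Rees: if this Ext vanished as well as those in lower degrees, I would contain a longer regular
sequence. -/
theorem not_subsingleton_ext_of_isRegular_maximal [IsNoetherianRing R] (I : Ideal R)
    (hI : I ≠ ⊤) (rs : List R) (hmem : ∀ r ∈ rs, r ∈ I)
    (hreg : RingTheory.Sequence.IsRegular R rs)
    (hmax : ∀ rs' : List R, RingTheory.Sequence.IsRegular R rs' → (∀ r ∈ rs', r ∈ I) →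
      rs'.length ≤ rs.length) :
    ¬ Subsingleton (Abelian.Ext (ModuleCat.of R (R ⧸ I)) (ModuleCat.of R R) rs.length) := by
  intro h
  have hlt : I • (⊤ : Submodule R (ModuleCat.of R R)) < ⊤ := by
    simpa [lt_top_iff_ne_top] using hI
  have hsupp : Module.support R (ModuleCat.of R (R ⧸ I)) = PrimeSpectrum.zeroLocus I := by
    change Module.support R (R ⧸ I) = _
    rw [Module.support_eq_zeroLocus, Ideal.annihilator_quotient]
  obtain ⟨rs', hlen, hmem', hreg'⟩ := ModuleCat.exists_isRegular_of_exists_subsingleton_ext I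
    (rs.length + 1) (ModuleCat.of R R) hlt (ModuleCat.of R (R ⧸ I)) hsupp fun i hi => by
      rcases (Nat.lt_succ_iff_lt_or_eq.mp hi) with hi | rfl
      · exact ModuleCat.subsingleton_ext_of_exists_isRegular I _ hsupp.subset _ hlt rs hmem hreg i hi
      · exact h
  have := hmax rs' hreg' hmem'
  omega

end

end

/-! ### Lengths, projective dimension and height for base changes of R/a -/

section

open TensorProduct RingTheory.Sequence CategoryTheory

section

variable {R : Type u} [CommRing R] {a : Ideal R}

/-- As xs lies in aL, all of L ⊗ R/a = L/aL is killed by xs and hence embeds into (L / xs L)^b. -/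
theorem TorsionEmbeds.length_quotient_le {n b : ℕ} (h : TorsionEmbeds a (R ⧸ a) n b) {L : Type u}
    [CommRing L] (ψ : R →+* L) (xs : List L) (hlen : xs.length = n)
    (hmem : ∀ x ∈ xs, x ∈ a.map ψ) (hreg : IsWeaklyRegular L xs) {c : ℕ}
    (hc : FiniteLengthBound L (L ⧸ (Ideal.ofList xs • ⊤ : Submodule L L)) c)
    (hfin : Module.length L (L ⧸ a.map ψ) ≠ ⊤) :
    Module.length L (L ⧸ a.map ψ) ≤ b * c := by
  let _ : Algebra R L := ψ.toAlgebra
  obtain ⟨f, hf⟩ := h L L xs hlen hmem hreg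
  let e : (L ⧸ a.map ψ) ≃ₗ[L] L ⊗[R] (R ⧸ a) :=
    (Algebra.TensorProduct.quotIdealMapEquivTensorQuot L a).toLinearEquiv
  have he (u : L ⧸ a.map ψ) :
      e u ∈ Submodule.torsionBySet L (L ⊗[R] (R ⧸ a)) {x | x ∈ xs} := by
    rw [Submodule.mem_torsionBySet_iff]
    rintro ⟨x, hx⟩
    obtain ⟨u, rfl⟩ := Ideal.Quotient.mk_surjective u
    change x • _ = _
    rw [← map_smul, ← map_zero e]
    congr 1
    exact Ideal.Quotient.eq_zero_iff_mem.mpr (Ideal.mul_mem_right _ _ (hmem x hx))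
  let f' := f ∘ₗ e.toLinearMap.codRestrict _ he
  have hf' : Function.Injective f' :=
    hf.comp fun u v huv => e.injective (congrArg Subtype.val huv)
  exact_mod_cast (hc.pi b).length_le f' hf' hfin

theorem hasProjectiveDimensionLE_quotient_map {S : Type u} [CommRing S] (ψ : R →+* S) (n : ℕ)
    (h : ∀ (S : Type u) [CommRing S] [Algebra R S] (xs : List S), n ≤ xs.length →
      (∀ x ∈ xs, x ∈ a.map (algebraMap R S)) → IsWeaklyRegular S xs →
      HasProjectiveDimensionLE (ModuleCat.of S (S ⊗[R] (R ⧸ a))) n)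
    (xs : List S) (hlen : xs.length = n) (hmem : ∀ x ∈ xs, x ∈ a.map ψ)
    (hreg : IsWeaklyRegular S xs) :
    HasProjectiveDimensionLE (ModuleCat.of S (S ⧸ a.map ψ)) n := by
  let _ : Algebra R S := ψ.toAlgebra
  have := h S xs hlen.ge hmem hreg
  let e : (S ⧸ a.map ψ) ≃ₗ[S] S ⊗[R] (R ⧸ a) :=
    (Algebra.TensorProduct.quotIdealMapEquivTensorQuot S a).toLinearEquiv
  exact hasProjectiveDimensionLT_of_iso e.symm.toModuleIso _

/-- In the localization at each minimal prime of a, every term of the sequence lowers the dimension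
by one. -/
theorem length_le_height_of_isRegular [IsNoetherianRing R] (rs : List R)
    (hreg : IsWeaklyRegular R rs) (hmem : ∀ r ∈ rs, r ∈ a) : (rs.length : ℕ∞) ≤ a.height := by
  rw [Ideal.height_eq_inf_minimalPrimes]
  refine le_iInf₂ fun P hP => ?_
  have := hP.1.1
  have hr := hreg.isRegular_of_isLocalization_of_mem (Localization.AtPrime P) P
    fun r hr => hP.1.2 (hmem r hr)
  have hd := ringKrullDim_add_length_eq_ringKrullDim_of_isRegular _ hr
  rw [IsLocalization.AtPrime.ringKrullDim_eq_height P (Localization.AtPrime P),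
    List.length_map] at hd
  have : Nontrivial (Localization.AtPrime P ⧸
      Ideal.ofList (rs.map (algebraMap R (Localization.AtPrime P)))) :=
    Ideal.Quotient.nontrivial_iff.mpr fun h => hr.2 (by simp [h])
  have h0 := ringKrullDim_nonneg_of_nontrivial (R := Localization.AtPrime P ⧸
      Ideal.ofList (rs.map (algebraMap R (Localization.AtPrime P))))
  have h1 : ((rs.length : ℕ∞) : WithBot ℕ∞) ≤ (P.height : WithBot ℕ∞) := by
    rw [← hd]
    exact le_add_of_nonneg_left h0
  exact_mod_cast h1

theorem le_of_choose_le {h g k C : ℕ} (hC : ∀ n, n.choose h ≤ C * (k * n + 1) ^ g) : h ≤ g := by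
  by_contra! hlt
  -- D collects all constants, so that evaluating at n = h + D gives (D + 1)^h ≤ D (D + 1)^g,
  -- impossible for h > g.
  set D := h.factorial * C * (k * h + k + 1) ^ g
  have key : (D + 1) ^ h ≤ D * (D + 1) ^ g :=
    calc (D + 1) ^ h = (h + D + 1 - h) ^ h := by congr 1; omega
      _ ≤ (h + D).descFactorial h := Nat.pow_sub_le_descFactorial _ _
      _ = h.factorial * (h + D).choose h := Nat.descFactorial_eq_factorial_mul_choose _ _
      _ ≤ h.factorial * (C * (k * (h + D) + 1) ^ g) := by gcongr; exact hC _
      _ ≤ h.factorial * (C * ((k * h + k + 1) * (D + 1)) ^ g) := by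
          gcongr
          nlinarith [Nat.zero_le (k * h * D)]
      _ = D * (D + 1) ^ g := by rw [mul_pow]; ring
  have h2 : (D + 1) ^ (g + 1) ≤ (D + 1) ^ h := Nat.pow_le_pow_right (Nat.succ_pos _) hlt
  have h3 : 0 < (D + 1) ^ g := by positivity
  rw [pow_succ] at h2
  nlinarith

theorem length_quotient_ne_top_of_maximalIdeal_pow_le {L : Type*} [CommRing L] [IsNoetherianRing L]
    [IsLocalRing L] {J : Ideal L} (k : ℕ) (h : IsLocalRing.maximalIdeal L ^ k ≤ J) :
    Module.length L (L ⧸ J) ≠ ⊤ := by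
  rw [Module.length_ne_top_iff, isFiniteLength_iff_isNoetherian_isArtinian]
  refine ⟨inferInstance, ?_⟩
  rcases subsingleton_or_nontrivial (L ⧸ J) with hJ | hJ
  · infer_instance
  have : IsLocalRing (L ⧸ J) :=
    IsLocalRing.of_surjective' (Ideal.Quotient.mk J) Ideal.Quotient.mk_surjective
  have : IsArtinianRing (L ⧸ J) := by
    rw [isArtinianRing_iff_isNilpotent_maximalIdeal]
    refine ⟨k, ?_⟩
    rw [← IsLocalRing.map_maximalIdeal_of_surjective (Ideal.Quotient.mk J)
      Ideal.Quotient.mk_surjective, ← Ideal.map_pow, Ideal.zero_eq_bot, eq_bot_iff,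
      Ideal.map_le_iff_le_comap]
    exact fun x hx => Ideal.Quotient.eq_zero_iff_mem.mpr (h hx)
  exact isArtinian_of_surjective_algebraMap (R := L ⧸ J) (S := L) Ideal.Quotient.mk_surjective

end

end

/-! ### Grade, height and cohomological dimension; monomial ideals -/

section

open TensorProduct RingTheory.Sequence CategoryTheory

section

variable {R : Type u} [CommRing R] {a : Ideal R}

theorem isWeaklyRegular_map_pow [IsNoetherianRing R] {rs : List R} (h : IsWeaklyRegular R rs)
    (s : ℕ) : IsWeaklyRegular R (rs.map (· ^ s)) := by
  -- The value of c is immaterial: only the regularity half of the next theorem is used.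
  obtain ⟨c, hc⟩ := exists_finiteLengthBound (R := R)
    (M := R ⧸ (Ideal.ofList rs • ⊤ : Submodule R R))
  exact (isWeaklyRegular_and_finiteLengthBound_map_pow rs h hc s).1

theorem height_le_of_torsionEmbeds [IsNoetherianRing R] (φ : ℕ → R →+* R) (ν : ℕ)
    (hφ : ∀ t, 1 ≤ t → a ^ (ν * t) ≤ a.map (φ t)) (hφ' : ∀ t, a.map (φ t) ≤ a ^ t)
    (rs : List R) (hreg : IsWeaklyRegular R rs) (hmem : ∀ r ∈ rs, r ∈ a) {b : ℕ}
    (hb : TorsionEmbeds a (R ⧸ a) rs.length b) (P : Ideal R) (hP : P ∈ a.minimalPrimes) :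
    P.height ≤ rs.length := by
  have := hP.1.1
  let L := Localization.AtPrime P
  let ι := algebraMap R L
  let m := IsLocalRing.maximalIdeal L
  have hPm : P.map ι = m := IsLocalization.AtPrime.map_eq_maximalIdeal P L
  -- Minimality of P makes aL primary to m; this serves only to make the quotients have finite
  -- length.
  obtain ⟨d, hd⟩ : ∃ d, m ^ d ≤ a.map ι := by
    refine Ideal.exists_pow_le_of_le_radical_of_fg ?_ (IsNoetherian.noetherian m)
    rw [IsLocalization.AtPrime.radical_map_of_mem_minimalPrimes L P a hP, hPm]
  obtain ⟨q, -, hq⟩ := Ideal.exists_ltSeries_length_eq_height m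
  have hheight : (q.length : ℕ∞) = P.height := by
    have h1 := IsLocalRing.maximalIdeal_height_eq_ringKrullDim (R := L)
    rw [IsLocalization.AtPrime.ringKrullDim_eq_height P L] at h1
    rw [hq]
    exact_mod_cast h1
  rw [← hheight]
  obtain ⟨k, hk⟩ := exists_choose_le_length_quotient q.length q rfl
  have hreg' : IsWeaklyRegular L (rs.map ι) :=
    (hreg.isRegular_of_isLocalization_of_mem L P fun r hr => hP.1.2 (hmem r hr)).1
  obtain ⟨c, hc⟩ := exists_finiteLengthBound (R := L)
    (M := L ⧸ (Ideal.ofList (rs.map ι) • ⊤ : Submodule L L))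
  have hbound (t : ℕ) (ht : 1 ≤ t) :
      Module.length L (L ⧸ a.map (ι.comp (φ t))) ≤ b * ((ν * t) ^ rs.length * c : ℕ) := by
    obtain ⟨hr, hl⟩ := isWeaklyRegular_and_finiteLengthBound_map_pow _ hreg' hc (ν * t)
    rw [List.length_map] at hl
    have hle : a.map ι ^ (ν * t) ≤ a.map (ι.comp (φ t)) := by
      rw [← Ideal.map_map, ← Ideal.map_pow]
      exact Ideal.map_mono (hφ t ht)
    refine hb.length_quotient_le (ι.comp (φ t)) ((rs.map ι).map (· ^ (ν * t))) (by simp) ?_ hr hl ?_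
    · intro x hx
      obtain ⟨y, hy, rfl⟩ := List.mem_map.mp hx
      obtain ⟨r, hr, rfl⟩ := List.mem_map.mp hy
      exact hle (Ideal.pow_mem_pow (Ideal.mem_map_of_mem _ (hmem r hr)) _)
    · refine length_quotient_ne_top_of_maximalIdeal_pow_le (d * (ν * t)) ?_
      rw [pow_mul]
      exact (Ideal.pow_right_mono hd _).trans hle
  have hle (n : ℕ) : n.choose q.length ≤ (b * (ν ^ rs.length * c)) * (k * n + 1) ^ rs.length := by
    have h1 : a.map (ι.comp (φ (k * n + 1))) ≤ q.head.asIdeal ⊔ m ^ (k * n + 1) := by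
      rw [← Ideal.map_map]
      refine (Ideal.map_mono (hφ' _)).trans (le_trans ?_ le_sup_right)
      rw [Ideal.map_pow, ← hPm]
      exact Ideal.pow_right_mono (Ideal.map_mono hP.1.2) _
    have h2 := (hk n).trans ((Module.length_le_of_surjective (Submodule.factor h1)
      (Submodule.factor_surjective h1)).trans (hbound _ (by omega)))
    have h3 : n.choose q.length ≤ b * ((ν * (k * n + 1)) ^ rs.length * c) := by exact_mod_cast h2
    refine h3.trans_eq ?_
    rw [mul_pow]
    ring
  exact_mod_cast le_of_choose_le hle

theorem Ideal.IsPerfect.ne_top (h : a.IsPerfect) : a ≠ ⊤ := by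
  rintro rfl
  have h0 : Limits.IsZero (ModuleCat.of R (R ⧸ (⊤ : Ideal R))) :=
    ModuleCat.isZero_of_iff_subsingleton.mpr inferInstance
  rw [Ideal.IsPerfect, (projectiveDimension_eq_bot_iff _).mpr h0] at h
  exact WithBot.bot_ne_coe h

theorem exists_isRegular_length_eq_grade [IsNoetherianRing R] (ha : a ≠ ⊤) :
    ∃ rs : List R, IsRegular R rs ∧ (∀ r ∈ rs, r ∈ a) ∧ a.grade = rs.length := by
  have : Nontrivial R := by
    by_contra h
    rw [not_nontrivial_iff_subsingleton] at h
    exact ha (Subsingleton.elim _ _)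
  let s : Set ℕ := {n | ∃ rs : List R, IsRegular R rs ∧ (∀ r ∈ rs, r ∈ a) ∧ rs.length = n}
  have hne : s.Nonempty := ⟨0, [], (isRegular_iff _ _).mpr (by simp), by simp, rfl⟩
  have hbdd : BddAbove s := by
    obtain ⟨n, hn⟩ := ENat.ne_top_iff_exists.mp (Ideal.height_ne_top ha)
    refine ⟨n, ?_⟩
    rintro _ ⟨rs, h1, h2, rfl⟩
    have := length_le_height_of_isRegular rs h1.1 h2
    rw [← hn] at this
    exact_mod_cast this
  obtain ⟨rs, h1, h2, h3⟩ := Nat.sSup_mem hne hbdd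
  refine ⟨rs, h1, h2, le_antisymm ?_ ?_⟩
  · refine iSup_le fun rs' => iSup_le fun h1' => iSup_le fun h2' => ?_
    rw [h3]
    exact_mod_cast le_csSup hbdd ⟨rs', h1', h2', rfl⟩
  · exact le_iSup_of_le rs (le_iSup_of_le h1 (le_iSup_of_le h2 le_rfl))

/-- A perfect ideal whose powers are cofinal with its images under ring endomorphisms, with linear
control on the exponents, has cohomological dimension equal to its height. -/
theorem Ideal.IsPerfect.cohomologicalDimension_eq_height [IsNoetherianRing R] (h : a.IsPerfect)
    (φ : ℕ → R →+* R) (ν : ℕ) (hφ : ∀ t, 1 ≤ t → a ^ (ν * t) ≤ a.map (φ t))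
    (hφ' : ∀ t, a.map (φ t) ≤ a ^ t) :
    a.cohomologicalDimension = a.height := by
  have ha := h.ne_top
  obtain ⟨rs, hreg, hmem, hgrade⟩ := exists_isRegular_length_eq_grade ha
  have hpd : HasProjectiveDimensionLE (ModuleCat.of R (R ⧸ a)) rs.length := by
    rw [← projectiveDimension_le_iff]
    exact (h.trans (by rw [hgrade]; rfl)).le
  obtain ⟨⟨b, hb⟩, hbase⟩ := exists_torsionEmbeds_and_hasProjectiveDimensionLE rs.length (R ⧸ a)
    (FactorsThroughProjective.quotient a) hpd
  have hheight : a.height = rs.length := by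
    refine le_antisymm ?_ (length_le_height_of_isRegular rs hreg.1 hmem)
    obtain ⟨P, hP⟩ := Ideal.nonempty_minimalPrimes ha
    exact (Ideal.height_mono hP.1.2).trans
      (height_le_of_torsionEmbeds φ ν hφ hφ' rs hreg.1 hmem hb P hP)
  rw [hheight]
  refine le_antisymm (sInf_le fun M i hi => ?_) (le_sInf fun c hc => ?_)
  · obtain ⟨i, rfl⟩ : ∃ j, i = j + 1 := ⟨i - 1, by
      have : rs.length < i := by exact_mod_cast hi
      omega⟩
    -- The index is t + 1 because `hφ` is available only from exponent 1 on.
    refine isZero_localCohomology_of_cofinal a i M fun t => ⟨ν * (t + 1), a.map (φ (t + 1)),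
      hφ _ (by omega), (hφ' _).trans (Ideal.pow_le_pow_right (by omega)), ?_⟩
    have := hasProjectiveDimensionLE_quotient_map (φ (t + 1)) rs.length hbase
      (rs.map (· ^ (ν * (t + 1)))) (by simp) (fun x hx => by
        obtain ⟨r, hr, rfl⟩ := List.mem_map.mp hx
        exact hφ _ (by omega) (Ideal.pow_mem_pow (hmem r hr) _))
      (isWeaklyRegular_map_pow hreg.1 _)
    exact HasProjectiveDimensionLT.subsingleton _ (rs.length + 1) (i + 1) (by exact_mod_cast hi) _
  · by_contra! hlt
    obtain ⟨g, hg⟩ : ∃ g, rs.length = g + 1 := ⟨rs.length - 1, by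
      have : 0 < rs.length := by exact_mod_cast (zero_le (a := c)).trans_lt hlt
      omega⟩
    refine not_isZero_localCohomology_of_injective a g (ModuleCat.of R R) ?_
      (ext_eq_zero_of_quotientFactor_comp_eq_zero a ha rs hmem hreg g hg)
      (hc _ _ (hg ▸ hlt))
    rw [← hg]
    refine not_subsingleton_ext_of_isRegular_maximal a ha rs hmem hreg fun rs' h1 h2 => ?_
    have : (rs'.length : ℕ∞) ≤ rs.length := hgrade ▸
      le_iSup_of_le rs' (le_iSup_of_le h1 (le_iSup_of_le h2 le_rfl))
    exact_mod_cast this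

/-- Pigeonhole: a product of that many generators contains some generator at least t times. -/
theorem span_pow_le_span_image_pow [DecidableEq R] (F : Finset R) (t : ℕ) :
    Ideal.span (F : Set R) ^ (F.card * t + 1) ≤ Ideal.span ((· ^ t) '' (F : Set R)) := by
  induction F using Finset.induction_on with
  | empty => simp
  | insert x F hx ih =>
    rw [Finset.card_insert_of_notMem hx, Finset.coe_insert, Ideal.span_insert, Set.image_insert_eq,
      Ideal.span_insert, show (F.card + 1) * t + 1 = t + (F.card * t + 1) by ring]
    refine Ideal.sup_pow_add_le_pow_sup_pow.trans (sup_le_sup ?_ ih)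
    rw [Ideal.span_singleton_pow]

theorem pow_le_map_of_eq_span (F : Finset R) (hF : a = Ideal.span (F : Set R)) (φ : R →+* R) {t : ℕ}
    (ht : 1 ≤ t) (hφ : ∀ x ∈ F, φ x = x ^ t) : a ^ ((F.card + 1) * t) ≤ a.map φ := by
  classical
  rw [hF, Ideal.map_span, Set.image_congr (g := (· ^ t)) hφ]
  exact (Ideal.pow_le_pow_right (by nlinarith)).trans (span_pow_le_span_image_pow F t)

theorem map_le_pow_of_eq_span (F : Finset R) (hF : a = Ideal.span (F : Set R)) (φ : R →+* R) {t : ℕ}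
    (hφ : ∀ x ∈ F, φ x = x ^ t) : a.map φ ≤ a ^ t := by
  conv_lhs => rw [hF, Ideal.map_span]
  rw [Ideal.span_le]
  rintro _ ⟨x, hx, rfl⟩
  rw [hφ x hx]
  exact Ideal.pow_mem_pow (hF ▸ Ideal.subset_span hx) t

end

end

theorem corollary2p3 {A : Type*} [CommRing A] [IsNoetherianRing A]
    {Γ : Type*} [AddCommMonoid Γ] [AddMonoid.FG Γ]
    (S : Set Γ) (𝔞 : Ideal (AddMonoidAlgebra A Γ))
    (h𝔞 : 𝔞 = Ideal.span ((fun γ : Γ => AddMonoidAlgebra.single γ (1 : A)) '' S))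
    (hperf : 𝔞.IsPerfect) :
    𝔞.cohomologicalDimension = 𝔞.height := by
  have : IsNoetherianRing (AddMonoidAlgebra A Γ) := Algebra.FiniteType.isNoetherianRing A _
  -- S may be infinite; the finite generating set is chosen among the monomials themselves, so that
  -- φ_t acts on it by t-th powers.
  obtain ⟨F, hFS, hF⟩ := Submodule.fg_span_iff_fg_span_finset_subset _ |>.mp
    (IsNoetherian.noetherian (Ideal.span
      ((fun γ : Γ => AddMonoidAlgebra.single γ (1 : A)) '' S)))
  rw [← Ideal.span, ← Ideal.span, ← h𝔞] at hF
  let φ (t : ℕ) : AddMonoidAlgebra A Γ →+* AddMonoidAlgebra A Γ :=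
    AddMonoidAlgebra.mapDomainRingHom A (nsmulAddMonoidHom (α := Γ) t)
  have hφ (t : ℕ) : ∀ x ∈ F, φ t x = x ^ t := by
    intro x hx
    obtain ⟨γ, -, rfl⟩ := hFS hx
    simp [φ, AddMonoidAlgebra.single_pow]
  exact hperf.cohomologicalDimension_eq_height φ (F.card + 1)
    (fun t ht => pow_le_map_of_eq_span F hF (φ t) ht (hφ t))
    (fun t => map_le_pow_of_eq_span F hF (φ t) (hφ t))
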